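/- Let $\mathbf{k}$ be a commutative ring with identity and $\lambda\in\mathbf{k}$; algebras are commutative $\mathbf{k}$-algebras with identity, operators are $\mathbf{k}$-linear, and tensor products are over $\mathbf{k}$. On an algebra $R$, an operator $P$ is a *Rota-Baxter operator of weight $\lambda$* if $P(x)P(y)=P(P(x)y)+P(xP(y))+\lambda P(xy)$ for all $x,y\in R$, and an operator $d$ is a *differential operator of weight $\lambda$* if $d(xy)=d(x)y+xd(y)+\lambda d(x)d(y)$ for all $x,y\in R$ and $d(1)=0$; then $(R,P)$ is called a Rota-Baxter algebra, respectively $(R,d)$ a differential algebra, of weight $\lambda$. For $\omega\in\mathbf{k}\langle x,y\rangle$ and operators $q,Q$ on $R$, let $\omega(q,Q)$ be the operator obtained by substituting $x\mapsto q$, $y\mapsto Q$. A *type $\omega$ differential Rota-Baxter algebra of weight $\lambda$* is a triple $(R,d,P)$ where $(R,d)$ is a differential algebra and $(R,P)$ a Rota-Baxter algebra, both of weight $\lambda$, and $\omega(d,P)=0$. Put $$\Omega_0=\{xy-a_0\mid a_0\in\mathbf{k}\}\cup\{xy-(b_0y+yx)\mid b_0\in\mathbf{k}\},\qquad \Omega_{\mathbf{k}}=\{xy,\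 xy-1,\ xy-yx\}.$$ *Hurwitz series.* $R^{\mathbb N}$ is the $\mathbf{k}$-module of sequences in $R$ with the product $(fg)_n=\sum_{k=0}^{n}\sum_{j=0}^{n-k}\binom nk\binom{n-k}{j}\lambda^kf_{n-j}g_{k+j}$, and $\partial_R(f)_n=f_{n+1}$. For an operator $P$ on $R$, $\widetilde P$ denotes the unique operator on $R^{\mathbb N}$ with $\widetilde P(f)_0=P(f_0)$ for all $f$ and $\omega(\partial_R,\widetilde P)=0$. *Mixable shuffle algebra.* The module $\bigoplus_{n\ge0}R^{\otimes n}$ carries the mixable shuffle product $*$ of weight $\lambda$, the bilinear product with unit $1\in R^{\otimes0}=\mathbf{k}$ and $(a\otimes t)*(b\otimes s)=a\otimes(t*(b\otimes s))+b\otimes((a\otimes t)*s)+\lambda\,ab\otimes(t*s)$; and $\mathrm{Sh}(R)=\bigoplus_{i\ge1}R^{\otimes i}=R\otimes\bigoplus_{n\ge0}R^{\otimes n}$ has the product $(a\otimes t)(b\otimes s)=ab\otimes(t*s)$. The operator $P_R$ on $\mathrm{Sh}(R)$ is given by $P_R(x_0\otimes\cdots\otimes x_n)=1\otimes x_0\otimes\cdots\otimes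 x_n$. For $\omega=xy-(\phi(x)+y\psi(x))$ with $\phi,\psi\in\mathbf{k}[x]$ and an operator $d$ on $R$ with $d(1)=0$, $\widetilde d$ denotes the unique operator on $\mathrm{Sh}(R)$ that restricts to $d$ on $R=R^{\otimes1}$, maps $\bigoplus_{i=1}^nR^{\otimes i}$ into itself for every $n\ge1$, and satisfies $$\widetilde d(u_0\otimes u')=d(u_0)\otimes u'+(u_0+\lambda d(u_0))\,\bigl(\phi(\widetilde d)+P_R\psi(\widetilde d)\bigr)(u')$$ for all $u_0\in R$, $u'\in R^{\otimes n}$, $n\ge1$. **Corollary.** Assume either that $\lambda=0$ and $\omega\in\Omega_0$, or that $\lambda$ is arbitrary and $\omega\in\Omega_{\mathbf{k}}$. Let $(R,P)$ be a Rota-Baxter algebra and $(R,d)$ a differential algebra, both of weight $\lambda$. Then the operators $\widetilde P$ and $\widetilde d$ exist and are unique, and $(R^{\mathbb N},\partial_R,\widetilde P)$ and $(\mathrm{Sh}(R),\widetilde d,P_R)$ are type $\omega$ differential Rota-Baxter algebras of weight $\lambda$. -/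

import Mathlib

open scoped TensorProduct
open Polynomial

/-! ### Operators, constraints and type `ω` differential Rota-Baxter algebras -/

section Operators

variable {K : Type*} [CommRing K] {R : Type*} [CommRing R] [Algebra K R]

/-- `P` is a Rota-Baxter operator of weight `lam` on the commutative `K`-algebra `R`. -/
def IsRotaBaxter (lam : K) (P : Module.End K R) : Prop :=
  ∀ x y : R, P x * P y = P (P x * y) + P (x * P y) + lam • P (x * y)

/-- `d` is a differential operator of weight `lam` on the commutative `K`-algebra `R`. -/
def IsDifferential (lam : K) (d : Module.End K R) : Prop :=
  (∀ x y : R, d (x * y) = d x * y + x * d y + lam • (d x * d y)) ∧ d 1 = 0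

end Operators

section Constraints

variable (K : Type*) [CommRing K]

/-- The noncommutative polynomial algebra `K⟨x, y⟩`. -/
abbrev NCPoly := FreeAlgebra K (Fin 2)

/-- The variable `x` of `K⟨x, y⟩`. -/
def ncX : NCPoly K := FreeAlgebra.ι K 0

/-- The variable `y` of `K⟨x, y⟩`. -/
def ncY : NCPoly K := FreeAlgebra.ι K 1

variable {K} in
/-- The polynomial `xy - (φ(x) + y ψ(x))`. -/
noncomputable def omegaPoly (φ ψ : K[X]) : NCPoly K :=
  ncX K * ncY K - (aeval (ncX K) φ + ncY K * aeval (ncX K) ψ)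

/-- The set `{xy - a₀ | a₀ ∈ K} ∪ {xy - (b₀ y + y x) | b₀ ∈ K}`. -/
def Omega0 : Set (NCPoly K) :=
  {ω | ∃ a : K, ω = ncX K * ncY K - algebraMap K (NCPoly K) a} ∪
    {ω | ∃ b : K, ω = ncX K * ncY K - (b • ncY K + ncY K * ncX K)}

/-- The set `{xy, xy - 1, xy - yx}`. -/
def OmegaK : Set (NCPoly K) :=
  {ncX K * ncY K, ncX K * ncY K - 1, ncX K * ncY K - ncY K * ncX K}

variable {K} in
/-- The operator `ω(q, Q)`, obtained by substituting `q` for `x` and `Q` for `y`; products are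
compositions of operators. -/
noncomputable def evalOp {M : Type*} [AddCommGroup M] [Module K M] (ω : NCPoly K)
    (q Q : Module.End K M) : Module.End K M :=
  FreeAlgebra.lift K ![q, Q] ω

variable {K} in
/-- `(R, d, P)` is a type `ω` differential Rota-Baxter algebra of weight `lam`. -/
def IsTypeDRB {R : Type*} [CommRing R] [Algebra K R] (lam : K) (ω : NCPoly K)
    (d P : Module.End K R) : Prop :=
  IsDifferential lam d ∧ IsRotaBaxter lam P ∧ evalOp ω d P = 0

end Constraints

/-! ### The algebra of `lam`-Hurwitz series -/

/-- The underlying set `A^ℕ` of the algebra of `lam`-Hurwitz series over `A`. -/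
def HurwitzSeries {K : Type*} (_lam : K) (A : Type*) : Type _ := ℕ → A

namespace HurwitzSeries

variable {K : Type*} [CommRing K] {lam : K} {A : Type*} [CommRing A] [Algebra K A]

instance : AddCommGroup (HurwitzSeries lam A) := inferInstanceAs (AddCommGroup (ℕ → A))

instance : Module K (HurwitzSeries lam A) := inferInstanceAs (Module K (ℕ → A))

/-- The `n`-th term `f_n` of a series `f`. -/
def coeff (n : ℕ) : HurwitzSeries lam A →ₗ[K] A := LinearMap.proj (R := K) (φ := fun _ : ℕ => A) n

/-- The shift `∂`, with `∂(f)_n = f_{n+1}`. -/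
def deriv : Module.End K (HurwitzSeries lam A) :=
  LinearMap.pi (R := K) (φ := fun _ : ℕ => A) fun n => coeff (lam := lam) (n + 1)

/-- The `lam`-Hurwitz product. -/
instance : Mul (HurwitzSeries lam A) where
  mul f g := fun n => ∑ k ∈ Finset.range (n + 1), ∑ j ∈ Finset.range (n - k + 1),
    (n.choose k * (n - k).choose j) • lam ^ k • (coeff (n - j) f * coeff (k + j) g)

/-- The identity `(1, 0, 0, …)`. -/
instance : One (HurwitzSeries lam A) where
  one := fun n => if n = 0 then 1 else 0

theorem ext {f g : HurwitzSeries lam A} (h : ∀ n, coeff n f = coeff n g) : f = g := funext h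

theorem coeff_mul (n : ℕ) (f g : HurwitzSeries lam A) :
    coeff n (f * g) = ∑ k ∈ Finset.range (n + 1), ∑ j ∈ Finset.range (n - k + 1),
      (n.choose k * (n - k).choose j) • lam ^ k • (coeff (n - j) f * coeff (k + j) g) := rfl

theorem coeff_deriv (n : ℕ) (f : HurwitzSeries lam A) :
    coeff n (deriv f) = coeff (n + 1) f := rfl

theorem coeff_one (n : ℕ) : coeff n (1 : HurwitzSeries lam A) = if n = 0 then 1 else 0 := rfl

theorem coeff_zero_one : coeff 0 (1 : HurwitzSeries lam A) = 1 := rfl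

theorem deriv_one : deriv (1 : HurwitzSeries lam A) = 0 := rfl

theorem coeff_zero_mul (f g : HurwitzSeries lam A) :
    coeff 0 (f * g) = coeff 0 f * coeff 0 g := by
  simp [coeff_mul]

/-- Shift in the first index of a double sequence. -/
def shL : Module.End K (ℕ → ℕ → A) where
  toFun F := fun i j => F (i + 1) j
  map_add' _ _ := rfl
  map_smul' _ _ := rfl

/-- Shift in the second index of a double sequence. -/
def shR : Module.End K (ℕ → ℕ → A) where
  toFun F := fun i j => F i (j + 1)
  map_add' _ _ := rfl
  map_smul' _ _ := rfl

theorem shL_pow (n : ℕ) (F : ℕ → ℕ → A) (i j : ℕ) :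
    ((shL (K := K)) ^ n) F i j = F (i + n) j := by
  induction n generalizing F with
  | zero => rfl
  | succ n ih => rw [pow_succ, Module.End.mul_apply, ih]; rfl

theorem shR_pow (n : ℕ) (F : ℕ → ℕ → A) (i j : ℕ) :
    ((shR (K := K)) ^ n) F i j = F i (j + n) := by
  induction n generalizing F with
  | zero => rfl
  | succ n ih => rw [pow_succ, Module.End.mul_apply, ih]; rfl

theorem shLR : Commute (shL (K := K) (A := A)) shR := rfl

/-- The double sequence `f_i g_j`. -/
def dbl (f g : HurwitzSeries lam A) : ℕ → ℕ → A := fun i j => coeff i f * coeff j g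

theorem coeff_mul_eq (n : ℕ) (f g : HurwitzSeries lam A) :
    coeff n (f * g) =
      ((lam • (shL * shR) + (shR + shL) : Module.End K (ℕ → ℕ → A)) ^ n) (dbl f g) 0 0 := by
  have h1 : Commute (lam • (shL * shR) : Module.End K (ℕ → ℕ → A)) (shR + shL) := by
    apply Commute.smul_left
    exact ((Commute.mul_left shLR (Commute.refl _)).add_right
      (Commute.mul_left (Commute.refl _) shLR.symm))
  rw [h1.add_pow, coeff_mul, LinearMap.sum_apply, Finset.sum_apply, Finset.sum_apply]
  refine Finset.sum_congr rfl fun k hk => ?_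
  rw [shLR.symm.add_pow, _root_.smul_pow, shLR.mul_pow, Finset.mul_sum, Finset.sum_mul,
    LinearMap.sum_apply, Finset.sum_apply, Finset.sum_apply]
  refine Finset.sum_congr rfl fun j hj => ?_
  have hj' : j ≤ n - k := Nat.lt_succ_iff.mp (Finset.mem_range.mp hj)
  have hk' : k ≤ n := Nat.lt_succ_iff.mp (Finset.mem_range.mp hk)
  have h2 : k + (n - k - j) = n - j := by omega
  simp only [Module.End.mul_apply, Module.End.natCast_apply, map_nsmul, LinearMap.smul_apply,
    Pi.smul_apply, shL_pow, shR_pow, dbl, zero_add]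
  rw [h2, mul_smul]

theorem deriv_mul (f g : HurwitzSeries lam A) :
    deriv (f * g) = deriv f * g + f * deriv g + lam • (deriv f * deriv g) := by
  apply ext
  intro n
  rw [coeff_deriv, map_add, map_add, map_smul]
  simp only [coeff_mul_eq]
  have h : (lam • (shL * shR) + (shR + shL) : Module.End K (ℕ → ℕ → A)) (dbl f g) =
      dbl (deriv f) g + dbl f (deriv g) + lam • dbl (deriv f) (deriv g) := by
    ext i j
    simp [shL, shR, dbl, coeff_deriv]
    ring
  rw [pow_succ, Module.End.mul_apply, h]
  simp

theorem mul_add' (f g h : HurwitzSeries lam A) : f * (g + h) = f * g + f * h := by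
  apply ext
  intro n
  simp only [coeff_mul, map_add, mul_add, smul_add, Finset.sum_add_distrib]

theorem smul_mul' (c : K) (f g : HurwitzSeries lam A) : (c • f) * g = c • (f * g) := by
  apply ext
  intro n
  simp only [coeff_mul, map_smul, smul_mul_assoc, Finset.smul_sum]
  refine Finset.sum_congr rfl fun k _ => Finset.sum_congr rfl fun j _ => ?_
  rw [smul_comm c, smul_comm c]

theorem mul_comm' (f g : HurwitzSeries lam A) : f * g = g * f := by
  apply ext
  intro n
  induction n generalizing f g with
  | zero => rw [coeff_zero_mul, coeff_zero_mul, mul_comm]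
  | succ n ih =>
    rw [← coeff_deriv, ← coeff_deriv, deriv_mul, deriv_mul]
    simp only [map_add, map_smul]
    rw [ih (deriv f) g, ih f (deriv g), ih (deriv f) (deriv g)]
    ring

theorem add_mul' (f g h : HurwitzSeries lam A) : (f + g) * h = f * h + g * h := by
  rw [mul_comm', mul_add', mul_comm' h, mul_comm' h]

theorem mul_smul' (c : K) (f g : HurwitzSeries lam A) : f * (c • g) = c • (f * g) := by
  rw [mul_comm', smul_mul', mul_comm' g]

theorem zero_mul' (f : HurwitzSeries lam A) : 0 * f = 0 := by
  have h := smul_mul' (0 : K) f f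
  rwa [zero_smul, zero_smul] at h

theorem mul_zero' (f : HurwitzSeries lam A) : f * 0 = 0 := by
  rw [mul_comm', zero_mul']

theorem mul_assoc' (f g h : HurwitzSeries lam A) : f * g * h = f * (g * h) := by
  apply ext
  intro n
  induction n generalizing f g h with
  | zero => simp only [coeff_zero_mul, mul_assoc]
  | succ n ih =>
    rw [← coeff_deriv, ← coeff_deriv]
    simp only [deriv_mul, add_mul', mul_add', smul_mul', mul_smul', map_add, map_smul, ih,
      smul_add]
    abel

theorem one_mul' (f : HurwitzSeries lam A) : 1 * f = f := by
  apply ext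
  intro n
  induction n generalizing f with
  | zero => rw [coeff_zero_mul, coeff_zero_one, one_mul]
  | succ n ih =>
    rw [← coeff_deriv, deriv_mul, deriv_one, zero_mul', zero_mul', smul_zero, zero_add, add_zero,
      ih, coeff_deriv]

instance : CommRing (HurwitzSeries lam A) where
  __ := (inferInstance : AddCommGroup (HurwitzSeries lam A))
  mul_assoc := mul_assoc'
  one_mul := one_mul'
  mul_one f := by rw [mul_comm', one_mul']
  left_distrib := mul_add'
  right_distrib := add_mul'
  zero_mul := zero_mul'
  mul_zero := mul_zero'
  mul_comm := mul_comm'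

instance : Algebra K (HurwitzSeries lam A) := Algebra.ofModule smul_mul' mul_smul'

end HurwitzSeries

/-! ### The mixable shuffle product algebra -/

/-- The module `⨁_{n ≥ 0} A^{⊗ n}` underlying the mixable shuffle (quasi-shuffle) algebra of weight
`lam`. Inside `TensorAlgebra K A` the tensor `a ⊗ t` is the product `ι a * t`; the
multiplication of `MixableShuffle lam A` is the mixable shuffle product below instead. -/
def MixableShuffle {K : Type*} [CommRing K] (_lam : K) (A : Type*) [CommRing A] [Algebra K A] :
    Type _ :=
  TensorAlgebra K A

namespace MixableShuffle

variable {K : Type*} [CommRing K] {lam : K} {A : Type*} [CommRing A] [Algebra K A]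

instance : AddCommGroup (MixableShuffle lam A) :=
  inferInstanceAs (AddCommGroup (TensorAlgebra K A))

instance : Module K (MixableShuffle lam A) := inferInstanceAs (Module K (TensorAlgebra K A))

/-- The empty tensor `1 ∈ K = A^{⊗ 0}`. -/
instance : One (MixableShuffle lam A) := ⟨(1 : TensorAlgebra K A)⟩

/-- Concatenation `(a, t) ↦ a ⊗ t`. -/
def cons : A →ₗ[K] MixableShuffle lam A →ₗ[K] MixableShuffle lam A :=
  (LinearMap.mul K (TensorAlgebra K A)).comp (TensorAlgebra.ι K)

/-- The pure tensor `a₁ ⊗ ⋯ ⊗ aₙ ∈ A^{⊗ n}`. -/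
def tensor (l : List A) : MixableShuffle lam A := l.foldr (fun a t => cons a t) 1

theorem induction {p : MixableShuffle lam A → Prop} (one : p 1)
    (smul : ∀ (c : K) t, p t → p (c • t)) (add : ∀ s t, p s → p t → p (s + t))
    (hcons : ∀ a t, p t → p (cons a t)) (t : MixableShuffle lam A) : p t := by
  have key : ∀ x : TensorAlgebra K A, ∀ y : TensorAlgebra K A, p y → p (x * y : TensorAlgebra K A) := by
    intro x
    induction x using TensorAlgebra.induction with
    | algebraMap r => intro y hy; rw [← Algebra.smul_def]; exact smul r y hy
    | ι a => intro y hy; exact hcons a y hy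
    | mul x x' hx hx' => intro y hy; rw [mul_assoc]; exact hx _ (hx' _ hy)
    | add x x' hx hx' => intro y hy; rw [add_mul]; exact add _ _ (hx _ hy) (hx' _ hy)
  exact (mul_one (M := TensorAlgebra K A) t) ▸ key t (1 : TensorAlgebra K A) one

/-- The linear map `r` out of `⨁ A^{⊗ n}` with `r 1 = m` and `r (a ⊗ t) = step a (r t)`. -/
def fold {M : Type*} [AddCommGroup M] [Module K M] (step : A →ₗ[K] Module.End K M) (m : M) :
    MixableShuffle lam A →ₗ[K] M :=
  (LinearMap.applyₗ m).comp (TensorAlgebra.lift K step).toLinearMap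

theorem fold_one {M : Type*} [AddCommGroup M] [Module K M] (step : A →ₗ[K] Module.End K M)
    (m : M) : fold step m (1 : MixableShuffle lam A) = m := by
  change (TensorAlgebra.lift K step) 1 m = m
  simp

theorem fold_cons {M : Type*} [AddCommGroup M] [Module K M] (step : A →ₗ[K] Module.End K M)
    (m : M) (a : A) (t : MixableShuffle lam A) :
    fold step m (cons a t) = step a (fold step m t) := by
  change (TensorAlgebra.lift K step) (TensorAlgebra.ι K a * (show TensorAlgebra K A from t)) m = _
  rw [map_mul, TensorAlgebra.lift_ι_apply]
  rfl

/-- `headTerm u a G = a ⊗ G u`. -/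
def headTerm : MixableShuffle lam A →ₗ[K]
    A →ₗ[K] Module.End K (MixableShuffle lam A) →ₗ[K] MixableShuffle lam A :=
  LinearMap.mk₂ K (fun u a => (cons a).comp (LinearMap.applyₗ u))
    (by intros; ext; simp) (by intros; ext; simp) (by intros; ext; simp) (by intros; ext; simp)

theorem headTerm_apply (u : MixableShuffle lam A) (a : A)
    (G : Module.End K (MixableShuffle lam A)) : headTerm u a G = cons a (G u) := rfl

/-- The recursion step used for `insertHead`. -/
def insertStep : A →ₗ[K] Module.End K
    ((A →ₗ[K] Module.End K (MixableShuffle lam A) →ₗ[K] MixableShuffle lam A) ×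
      MixableShuffle lam A) :=
  LinearMap.mk₂ K
    (fun b p => (headTerm (cons b p.2) + p.1.compr₂ (cons b) +
      lam • (headTerm p.2).comp (LinearMap.mulRight K b), cons b p.2))
    (by
      intro b b' p
      refine Prod.ext (LinearMap.ext fun a => LinearMap.ext fun G => ?_) (by simp)
      simp [headTerm_apply, mul_add]
      abel)
    (by
      intro c b p
      refine Prod.ext (LinearMap.ext fun a => LinearMap.ext fun G => ?_) (by simp)
      simp [headTerm_apply, smul_comm lam c])
    (by
      intro b p p'
      refine Prod.ext (LinearMap.ext fun a => LinearMap.ext fun G => ?_) (by simp)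
      simp [headTerm_apply]
      abel)
    (by
      intro c b p
      refine Prod.ext (LinearMap.ext fun a => LinearMap.ext fun G => ?_) (by simp)
      simp [headTerm_apply, smul_comm lam c])

/-- If `G s = t * s` is the mixable shuffle product with `t`, then `insertHead s a G` is
`(a ⊗ t) * s`; see `insertHead_one` and `insertHead_cons` for the recursion. -/
def insertHead : MixableShuffle lam A →ₗ[K]
    A →ₗ[K] Module.End K (MixableShuffle lam A) →ₗ[K] MixableShuffle lam A :=
  (LinearMap.fst K _ _).comp (fold insertStep (headTerm 1, 1))

theorem fold_insertStep_snd (s : MixableShuffle lam A) :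
    (fold insertStep (headTerm 1, 1) s).2 = s := by
  induction s using induction with
  | one => rw [fold_one]
  | smul c t ih => rw [map_smul, Prod.smul_snd, ih]
  | add s t hs ht => rw [map_add, Prod.snd_add, hs, ht]
  | hcons a t ih => rw [fold_cons]; exact congrArg (cons a) ih

theorem insertHead_one (a : A) (G : Module.End K (MixableShuffle lam A)) :
    insertHead 1 a G = cons a (G 1) := by
  rw [insertHead, LinearMap.comp_apply, fold_one]
  rfl

theorem insertHead_cons (b : A) (s : MixableShuffle lam A) (a : A)
    (G : Module.End K (MixableShuffle lam A)) :
    insertHead (cons b s) a G =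
      cons a (G (cons b s)) + cons b (insertHead s a G) + lam • cons (a * b) (G s) := by
  have h := fold_insertStep_snd s
  rw [insertHead, LinearMap.comp_apply, fold_cons]
  change cons a (G (cons b (fold insertStep (headTerm 1, 1) s).2)) + cons b (insertHead s a G) +
    lam • cons (a * b) (G (fold insertStep (headTerm 1, 1) s).2) = _
  rw [h]
  rfl

/-- The mixable shuffle product of weight `lam`, as a bilinear map. It is characterized by
`1 * s = s`, `t * 1 = t` and
`(a ⊗ t) * (b ⊗ s) = a ⊗ (t * (b ⊗ s)) + b ⊗ ((a ⊗ t) * s) + lam (a b) ⊗ (t * s)`. -/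
def shuffle : MixableShuffle lam A →ₗ[K] Module.End K (MixableShuffle lam A) :=
  fold (LinearMap.mk₂ K (fun a G => (insertHead.flip a).flip G)
    (by intros; ext; simp) (by intros; ext; simp) (by intros; ext; simp) (by intros; ext; simp))
    LinearMap.id

instance : Mul (MixableShuffle lam A) := ⟨fun t s => shuffle t s⟩

theorem mul_def (t s : MixableShuffle lam A) : t * s = shuffle t s := rfl

theorem one_mul' (s : MixableShuffle lam A) : 1 * s = s := by
  rw [mul_def, shuffle, fold_one, LinearMap.id_apply]

theorem cons_mul (a : A) (t s : MixableShuffle lam A) :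
    cons a t * s = insertHead s a (shuffle t) := by
  rw [mul_def, shuffle, fold_cons]
  rfl

theorem cons_mul_one (a : A) (t : MixableShuffle lam A) : cons a t * 1 = cons a (t * 1) := by
  rw [cons_mul, insertHead_one]
  rfl

theorem cons_mul_cons (a b : A) (t s : MixableShuffle lam A) :
    cons a t * cons b s =
      cons a (t * cons b s) + cons b (cons a t * s) + lam • cons (a * b) (t * s) := by
  rw [cons_mul, insertHead_cons, cons_mul]
  rfl

theorem add_mul' (t t' s : MixableShuffle lam A) : (t + t') * s = t * s + t' * s := by
  simp only [mul_def, map_add, LinearMap.add_apply]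

theorem mul_add' (t s s' : MixableShuffle lam A) : t * (s + s') = t * s + t * s' := by
  simp only [mul_def, map_add]

theorem smul_mul' (c : K) (t s : MixableShuffle lam A) : (c • t) * s = c • (t * s) := by
  simp only [mul_def, map_smul, LinearMap.smul_apply]

theorem mul_smul' (c : K) (t s : MixableShuffle lam A) : t * (c • s) = c • (t * s) := by
  simp only [mul_def, map_smul]

theorem mul_one' (t : MixableShuffle lam A) : t * 1 = t := by
  induction t using induction with
  | one => exact one_mul' 1
  | smul c t ih => rw [smul_mul', ih]
  | add s t hs ht => rw [add_mul', hs, ht]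
  | hcons a t ih => rw [cons_mul_one, ih]

theorem mul_comm' (t s : MixableShuffle lam A) : t * s = s * t := by
  induction t using induction generalizing s with
  | one => rw [one_mul', mul_one']
  | smul c t ih => rw [smul_mul', mul_smul', ih]
  | add t t' h h' => rw [add_mul', mul_add', h, h']
  | hcons a t ih =>
    induction s using induction with
    | one => rw [one_mul', mul_one']
    | smul c s ih' => rw [smul_mul', mul_smul', ih']
    | add s s' h h' => rw [add_mul', mul_add', h, h']
    | hcons b s ih' =>
      rw [cons_mul_cons, cons_mul_cons, ih', ih s, ih (cons b s), mul_comm a b]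
      abel

theorem mul_assoc' (t s u : MixableShuffle lam A) : t * s * u = t * (s * u) := by
  induction t using induction generalizing s u with
  | one => rw [one_mul', one_mul']
  | smul c t ih => rw [smul_mul', smul_mul', smul_mul', ih]
  | add t t' h h' => rw [add_mul', add_mul', add_mul', h, h']
  | hcons a t iht =>
    induction s using induction generalizing u with
    | one => rw [one_mul', mul_one']
    | smul c s ih => rw [smul_mul', mul_smul', smul_mul', mul_smul', ih]
    | add s s' h h' => rw [add_mul', mul_add', add_mul', mul_add', h, h']
    | hcons b s ihs =>
      induction u using induction with
      | one => rw [mul_one', mul_one']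
      | smul c u ih => rw [mul_smul', mul_smul', mul_smul', ih]
      | add u u' h h' => rw [mul_add', mul_add', mul_add', h, h']
      | hcons c u ihu =>
        have h1 := cons_mul_cons (lam := lam) a b t s
        have h2 := cons_mul_cons (lam := lam) b c s u
        have e1 : cons a t * cons b s * cons c u =
            cons a (t * cons b s * cons c u) + cons b (cons a t * s * cons c u) +
            lam • cons (a * b) (t * s * cons c u) + cons c (cons a t * cons b s * u) +
            lam • (cons (a * c) (t * cons b s * u) + cons (b * c) (cons a t * s * u) +
              lam • cons (a * b * c) (t * s * u)) := by
          rw [h1]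
          simp only [add_mul', smul_mul', cons_mul_cons, map_add, map_smul, smul_add]
          abel
        have e2 : cons a t * (cons b s * cons c u) =
            cons a (t * (cons b s * cons c u)) + cons b (cons a t * (s * cons c u)) +
            lam • cons (a * b) (t * (s * cons c u)) + cons c (cons a t * (cons b s * u)) +
            lam • (cons (a * c) (t * (cons b s * u)) + cons (b * c) (cons a t * (s * u)) +
              lam • cons (a * b * c) (t * (s * u))) := by
          rw [h2]
          simp only [mul_add', mul_smul', cons_mul_cons, map_add, map_smul, smul_add, mul_assoc]
          abel
        rw [e1, e2, ihu, iht, iht, iht, iht, ihs, ihs]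

theorem zero_mul' (t : MixableShuffle lam A) : 0 * t = 0 := by
  rw [mul_def, map_zero, LinearMap.zero_apply]

theorem mul_zero' (t : MixableShuffle lam A) : t * 0 = 0 := by
  rw [mul_def, map_zero]

/-- The mixable shuffle product makes `⨁_{n ≥ 0} A^{⊗ n}` a commutative ring. -/
instance : CommRing (MixableShuffle lam A) where
  __ := (inferInstance : AddCommGroup (MixableShuffle lam A))
  mul_assoc := mul_assoc'
  one_mul := one_mul'
  mul_one := mul_one'
  left_distrib := mul_add'
  right_distrib := add_mul'
  zero_mul := zero_mul'
  mul_zero := mul_zero'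
  mul_comm := mul_comm'

instance : Algebra K (MixableShuffle lam A) := Algebra.ofModule smul_mul' mul_smul'

end MixableShuffle

/-- The free commutative Rota-Baxter algebra `Ш(A) = ⨁_{i ≥ 1} A^{⊗ i} = A ⊗ (⨁_{n ≥ 0} A^{⊗ n})`
of weight `lam`. Its product is `(a ⊗ t) (b ⊗ s) = (a b) ⊗ (t * s)`, where `t * s` is the mixable
shuffle product; the tensor `a ⊗ₜ tensor [a₁, …, aₙ]` is `a ⊗ a₁ ⊗ ⋯ ⊗ aₙ`. -/
abbrev Sha {K : Type*} [CommRing K] (lam : K) (A : Type*) [CommRing A] [Algebra K A] : Type _ :=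
  A ⊗[K] MixableShuffle lam A

namespace Sha

variable {K : Type*} [CommRing K] {lam : K} {A : Type*} [CommRing A] [Algebra K A]

/-- The embedding `j : A → Ш(A)` onto the summand `A^{⊗ 1}`. -/
def incl : A →ₐ[K] Sha lam A := Algebra.TensorProduct.includeLeft

/-- The identification of `A^{⊗ n}` with `A^{⊗ n} ⊆ ⨁_{n ≥ 0} A^{⊗ n}` for `n ≥ 1`:
`a ⊗ t ↦ a ⊗ t`. -/
def toShuffle : Sha lam A →ₗ[K] MixableShuffle lam A := TensorProduct.lift MixableShuffle.cons

/-- The operator `P`, with `P(x₀ ⊗ ⋯ ⊗ xₙ) = 1 ⊗ x₀ ⊗ ⋯ ⊗ xₙ`. -/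
def P : Module.End K (Sha lam A) := (TensorProduct.mk K A (MixableShuffle lam A) 1).comp toShuffle

/-- The submodule `A^{⊗ 1} ⊕ ⋯ ⊕ A^{⊗ n}` of `Ш(A)`. -/
def upTo (lam : K) (A : Type*) [CommRing A] [Algebra K A] (n : ℕ) : Submodule K (Sha lam A) :=
  Submodule.span K
    {u | ∃ (a : A) (l : List A), l.length + 1 ≤ n ∧ u = a ⊗ₜ[K] MixableShuffle.tensor l}

end Sha

/-! ### Covers and extensions of operators -/

section CoversExtensions

variable {K : Type*} [CommRing K] {lam : K} {R : Type*} [CommRing R] [Algebra K R]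

/-- `Q'` is a cover of `Q` on `R^ℕ`. -/
def IsCover (Q : Module.End K R) (Q' : Module.End K (HurwitzSeries lam R)) : Prop :=
  ∀ f : HurwitzSeries lam R, HurwitzSeries.coeff 0 (Q' f) = Q (HurwitzSeries.coeff 0 f)

/-- `Q'` is the cover `Q̃` of `Q` attached to the constraint `ω`: the cover such that
`ω(∂, Q̃) = 0`. -/
def IsOmegaCover (ω : NCPoly K) (Q : Module.End K R)
    (Q' : Module.End K (HurwitzSeries lam R)) : Prop :=
  IsCover Q Q' ∧ evalOp ω HurwitzSeries.deriv Q' = 0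

/-- `q'` is an extension of `q` to `Ш(R)`. -/
def IsExtension (q : Module.End K R) (q' : Module.End K (Sha lam R)) : Prop :=
  ∀ a : R, q' (Sha.incl a) = Sha.incl (q a)

/-- `q'` is the extension `q̃` of `q` attached to the constraint `ω = xy - (φ(x) + y ψ(x))`: for
`u = u₀ ⊗ u'` with `u' ∈ R^{⊗ n}`, `n ≥ 1`,
`q̃(u) = q(u₀) ⊗ u' + (u₀ + lam q(u₀)) (φ(q̃) + P ψ(q̃))(u')`,
and `q̃` preserves each `R^{⊗ 1} ⊕ ⋯ ⊕ R^{⊗ n}`, `n ≥ 1`. -/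
def IsOmegaExtension (ω : NCPoly K) (q : Module.End K R) (q' : Module.End K (Sha lam R)) : Prop :=
  IsExtension q q' ∧
  (∃ φ ψ : K[X], ω = omegaPoly φ ψ ∧
    ∀ (u₀ : R) (u' : Sha lam R),
      q' (u₀ ⊗ₜ[K] Sha.toShuffle u') =
        q u₀ ⊗ₜ[K] Sha.toShuffle u' +
          Sha.incl (u₀ + lam • q u₀) *
            (aeval q' φ + Sha.P * aeval q' ψ : Module.End K (Sha lam R)) u') ∧
  ∀ n : ℕ, 1 ≤ n → ∀ u ∈ Sha.upTo lam R n, q' u ∈ Sha.upTo lam R n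

end CoversExtensions

/-! ### Normal form of the constraints -/

section Constraints

variable {K : Type*} [CommRing K]

/-! Every admissible constraint says `DQ = a + bQ + cQD` for scalars with either `b = c = 0` and
`λa² = λa`, or `a = 0`, `c = 1` and `λb = 0` (`exists_affineConstraint`). Such an equation is a
recursion. Read on Hurwitz series with `D = ∂`, it gives coefficient `n + 1` of the cover from
coefficient `n`. Read on tensors with `Q = P_R`, it gives the extension on `1 ⊗ u` from its value on
the shorter `u`. Hence existence and uniqueness on both sides.

The remaining axiom is in each case a compatibility of the Leibniz rule with the Rota-Baxter
identity. Let `E(x, y) = Q(x)Q(y) - Q(Q(x)y + xQ(y) + λxy)`. If `D` satisfies the Leibniz rule, then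
`D E(x, y)` is `0` in the first case, and `2b E(x, y) + E(Dx, y) + E(x, Dy) + λ E(Dx, Dy)` in the
second.

For the cover, `∂` is a derivation and `E` has zeroth coefficient `0`, so induction on coefficients
gives `E = 0` (`isRotaBaxter_cover`). For the extension, `E = 0` is the shuffle recursion, and the
same computation run backwards carries the Leibniz rule from shorter tensors to `P(x)P(y)`
(`LeibnizAt.of_isRotaBaxter`, `leibnizAt_extend_one_tmul`). -/

theorem omegaPoly_injective {φ ψ φ' ψ' : K[X]} (h : omegaPoly φ ψ = omegaPoly φ' ψ') :
    φ = φ' ∧ ψ = ψ' := by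
  -- Substituting the commuting pair `X`, `y` in `K[X]` loses nothing here: `y = 0` isolates `φ`,
  -- then `y = 1` isolates `ψ`.
  have key (y : K[X]) : X * y - (φ + y * ψ) = X * y - (φ' + y * ψ') := by
    have := congrArg (FreeAlgebra.lift K ![(X : K[X]), y]) h
    simpa [omegaPoly, ncX, ncY, ← aeval_algHom_apply] using this
  have h0 : φ = φ' := by simpa using key 0
  exact ⟨h0, by simpa [h0] using key 1⟩

theorem evalOp_omegaPoly {M : Type*} [AddCommGroup M] [Module K M] (φ ψ : K[X])
    (q Q : Module.End K M) :
    evalOp (omegaPoly φ ψ) q Q = q * Q - (aeval q φ + Q * aeval q ψ) := by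
  simp [evalOp, omegaPoly, ncX, ncY, ← aeval_algHom_apply]

/-- The constraint `xy - (a + y (b + c x))`. -/
noncomputable def affineConstraint (a b c : K) : NCPoly K := omegaPoly (C a) (C b + C c * X)

theorem evalOp_affineConstraint_eq_zero_iff {M : Type*} [AddCommGroup M] [Module K M]
    (a b c : K) (q Q : Module.End K M) :
    evalOp (affineConstraint a b c) q Q = 0 ↔
      ∀ x, q (Q x) = a • x + b • Q x + c • Q (q x) := by
  rw [affineConstraint, evalOp_omegaPoly, sub_eq_zero, LinearMap.ext_iff]
  simp [Algebra.algebraMap_eq_smul_one, add_assoc]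

/-- The triples `(a, b, c)` for which `xy - (a + y (b + c x))` is compatible with the weight. -/
def IsCompatible (lam a b c : K) : Prop :=
  (b = 0 ∧ c = 0 ∧ lam * (a * a) = lam * a) ∨ (a = 0 ∧ c = 1 ∧ lam * b = 0)

/-- Weight zero makes both conditions on scalars vacuous; in arbitrary weight only `a ∈ {0, 1}` and
`b = 0` occur, where they hold trivially. -/
theorem exists_affineConstraint {lam : K} {ω : NCPoly K}
    (hω : (lam = 0 ∧ ω ∈ Omega0 K) ∨ ω ∈ OmegaK K) :
    ∃ a b c : K, ω = affineConstraint a b c ∧ IsCompatible lam a b c := by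
  rcases hω with ⟨rfl, ⟨a, rfl⟩ | ⟨b, rfl⟩⟩ | rfl | rfl | rfl
  · exact ⟨a, 0, 0, by simp [affineConstraint, omegaPoly], Or.inl (by simp)⟩
  · exact ⟨0, b, 1, by simp [affineConstraint, omegaPoly, mul_add, Algebra.smul_def,
      Algebra.commutes], Or.inr (by simp)⟩
  · exact ⟨0, 0, 0, by simp [affineConstraint, omegaPoly], Or.inl (by simp)⟩
  · exact ⟨1, 0, 0, by simp [affineConstraint, omegaPoly], Or.inl (by simp)⟩
  · exact ⟨0, 0, 1, by simp [affineConstraint, omegaPoly], Or.inr (by simp)⟩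

end Constraints

/-! ### Leibniz rule against Rota-Baxter identity -/

section RotaBaxterDefect

variable {K : Type*} [CommRing K] {S : Type*} [CommRing S] [Algebra K S]

/-- The argument of `Q` in the Rota-Baxter identity. -/
def rotaBaxterArg (lam : K) (Q : Module.End K S) (x y : S) : S :=
  Q x * y + x * Q y + lam • (x * y)

theorem isRotaBaxter_iff {lam : K} {Q : Module.End K S} :
    IsRotaBaxter lam Q ↔ ∀ x y, Q x * Q y = Q (rotaBaxterArg lam Q x y) := by
  simp [IsRotaBaxter, rotaBaxterArg]

/-- The Leibniz rule of weight `lam` at a pair of elements. -/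
def LeibnizAt (lam : K) (D : Module.End K S) (x y : S) : Prop :=
  D (x * y) = D x * y + x * D y + lam • (D x * D y)

/-- The Leibniz rule is required only at the three products inside the argument, so that the lemma
can serve inside an induction. All leftover terms carry the factor `lam * b`. -/
theorem map_rotaBaxterArg {lam b : K} {D Q : Module.End K S} (hb : lam * b = 0)
    (hQ : ∀ x, D (Q x) = b • Q x + Q (D x)) {x y : S} (h1 : LeibnizAt lam D (Q x) y)
    (h2 : LeibnizAt lam D x (Q y)) (h3 : LeibnizAt lam D x y) :
    D (rotaBaxterArg lam Q x y) = b • rotaBaxterArg lam Q x y + rotaBaxterArg lam Q (D x) y +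
      rotaBaxterArg lam Q x (D y) + lam • rotaBaxterArg lam Q (D x) (D y) := by
  unfold LeibnizAt at h1 h2 h3
  have hb' : algebraMap K S lam * algebraMap K S b = 0 := by rw [← map_mul, hb, map_zero]
  simp only [rotaBaxterArg, map_add, map_smul, h1, h2, h3, hQ]
  simp only [Algebra.smul_def]
  linear_combination (Q x * D y + D x * Q y - x * y) * hb'

/-- Pure substitution of the constraint. The term in `b` appears twice, as it does in `D (Q
(rotaBaxterArg lam Q x y))`: once from the outer `Q`, once from `map_rotaBaxterArg`. -/
theorem leibniz_rhs {lam b : K} {D Q : Module.End K S} (hb : lam * b = 0)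
    (hQ : ∀ x, D (Q x) = b • Q x + Q (D x)) (x y : S) :
    D (Q x) * Q y + Q x * D (Q y) + lam • (D (Q x) * D (Q y)) =
      b • (Q x * Q y) + b • (Q x * Q y) + Q (D x) * Q y + Q x * Q (D y) +
        lam • (Q (D x) * Q (D y)) := by
  have hb' : algebraMap K S lam * algebraMap K S b = 0 := by rw [← map_mul, hb, map_zero]
  simp only [hQ, Algebra.smul_def]
  linear_combination (algebraMap K S b * Q x * Q y + Q x * Q (D y) + Q (D x) * Q y) * hb'

/-- The two sides differ by `lam * (a² - a)` times `x * y`. -/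
theorem leibniz_rhs_of_scalar {lam a : K} {D Q : Module.End K S} (ha : lam * (a * a) = lam * a)
    (hQ : ∀ x, D (Q x) = a • x) (x y : S) :
    D (Q x) * Q y + Q x * D (Q y) + lam • (D (Q x) * D (Q y)) = D (Q (rotaBaxterArg lam Q x y)) := by
  have ha' : algebraMap K S lam * (algebraMap K S a * algebraMap K S a) =
    algebraMap K S lam * algebraMap K S a := by simp only [← map_mul, ha]
  simp only [hQ, rotaBaxterArg, Algebra.smul_def]
  linear_combination x * y * ha'

/-- If `Q` is a Rota-Baxter operator, the Leibniz rule for `D` propagates along `Q`. -/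
theorem LeibnizAt.of_isRotaBaxter {lam a b c : K} {D Q : Module.End K S}
    (habc : IsCompatible lam a b c) (hQ : ∀ x, D (Q x) = a • x + b • Q x + c • Q (D x))
    (hRB : IsRotaBaxter lam Q) {x y : S} (h1 : LeibnizAt lam D (Q x) y)
    (h2 : LeibnizAt lam D x (Q y)) (h3 : LeibnizAt lam D x y) : LeibnizAt lam D (Q x) (Q y) := by
  rw [isRotaBaxter_iff] at hRB
  unfold LeibnizAt
  rcases habc with ⟨rfl, rfl, ha⟩ | ⟨rfl, rfl, hb⟩
  · rw [leibniz_rhs_of_scalar ha (by simpa using hQ), hRB]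
  · simp only [zero_smul, zero_add, one_smul] at hQ
    rw [leibniz_rhs hb hQ]
    simp only [hRB]
    rw [hQ, map_rotaBaxterArg hb hQ h1 h2 h3]
    simp only [map_add, map_smul]
    abel

end RotaBaxterDefect

/-! ### The cover on Hurwitz series -/

namespace HurwitzSeries

variable {K : Type*} [CommRing K] {lam : K} {A : Type*} [CommRing A] [Algebra K A]

theorem isDifferential_deriv : IsDifferential lam (deriv (lam := lam) (A := A) (K := K)) :=
  ⟨deriv_mul, deriv_one⟩

/-- The coefficients of the cover of `Q` attached to `xy - (a + y (b + c x))`. -/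
def coverCoeff (a b c : K) (Q : Module.End K A) : ℕ → HurwitzSeries lam A →ₗ[K] A
  | 0 => Q.comp (coeff 0)
  | n + 1 => a • coeff n + b • coverCoeff a b c Q n + c • (coverCoeff a b c Q n).comp deriv

/-- The cover of `Q` attached to `xy - (a + y (b + c x))`. -/
def cover (a b c : K) (Q : Module.End K A) : Module.End K (HurwitzSeries lam A) :=
  LinearMap.pi (R := K) (φ := fun _ : ℕ => A) (coverCoeff a b c Q)

theorem coeff_zero_cover (a b c : K) (Q : Module.End K A) (f : HurwitzSeries lam A) :
    coeff 0 (cover a b c Q f) = Q (coeff 0 f) := rfl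

theorem deriv_cover (a b c : K) (Q : Module.End K A) (f : HurwitzSeries lam A) :
    deriv (cover a b c Q f) = a • f + b • cover a b c Q f + c • cover a b c Q (deriv f) := rfl

theorem isOmegaCover_cover (a b c : K) (Q : Module.End K A) :
    IsOmegaCover (affineConstraint a b c) Q (cover (lam := lam) a b c Q) :=
  ⟨coeff_zero_cover a b c Q, (evalOp_affineConstraint_eq_zero_iff ..).2 (deriv_cover a b c Q)⟩

/-- The cover condition fixes coefficient `0`, and the constraint expresses coefficient `n + 1`
through coefficient `n` at `f` and at `deriv f`; hence the induction over all `f` at once. -/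
theorem eq_of_isOmegaCover {a b c : K} {Q : Module.End K A}
    {Q₁ Q₂ : Module.End K (HurwitzSeries lam A)}
    (h₁ : IsOmegaCover (affineConstraint a b c) Q Q₁)
    (h₂ : IsOmegaCover (affineConstraint a b c) Q Q₂) : Q₁ = Q₂ := by
  have h₁' := (evalOp_affineConstraint_eq_zero_iff ..).1 h₁.2
  have h₂' := (evalOp_affineConstraint_eq_zero_iff ..).1 h₂.2
  refine LinearMap.ext fun f => ext fun n => ?_
  induction n generalizing f with
  | zero => rw [h₁.1, h₂.1]
  | succ n ih =>
    rw [← coeff_deriv, ← coeff_deriv, h₁', h₂']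
    simp only [map_add, map_smul, ih]

theorem isRotaBaxter_cover {a b c : K} (habc : IsCompatible lam a b c) {Q : Module.End K A}
    (hQ : IsRotaBaxter lam Q) : IsRotaBaxter lam (cover (lam := lam) a b c Q) := by
  rw [isRotaBaxter_iff]
  intro f g
  apply ext
  intro n
  induction n generalizing f g with
  | zero =>
    simp only [coeff_zero_mul, coeff_zero_cover, rotaBaxterArg, map_add, map_smul, hQ _ _]
  | succ n ih =>
    have hD := deriv_cover (lam := lam) a b c Q
    rw [← coeff_deriv, ← coeff_deriv, deriv_mul]
    rcases habc with ⟨rfl, rfl, ha⟩ | ⟨rfl, rfl, hb⟩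
    -- Here the derivatives of both sides already agree, without the induction hypothesis.
    · rw [leibniz_rhs_of_scalar ha (by simpa using hD)]
    · simp only [zero_smul, zero_add, one_smul] at hD
      rw [leibniz_rhs hb hD, hD,
        map_rotaBaxterArg hb hD (deriv_mul _ _) (deriv_mul _ _) (deriv_mul _ _)]
      -- The induction hypothesis is used at `(f, g)` and at the pairs with one or both entries
      -- differentiated.
      simp only [map_add, map_smul, ih]
      abel

end HurwitzSeries

/-! ### Bilinearity of the Leibniz rule -/

section LeibnizAt

variable {K : Type*} [CommRing K] {S : Type*} [CommRing S] [Algebra K S] {lam : K}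
  {D : Module.End K S}

theorem LeibnizAt.symm {x y : S} (h : LeibnizAt lam D x y) : LeibnizAt lam D y x := by
  unfold LeibnizAt at *
  rw [mul_comm y x, h, mul_comm (D y) (D x)]
  ring

theorem LeibnizAt.add_left {x x' y : S} (h : LeibnizAt lam D x y) (h' : LeibnizAt lam D x' y) :
    LeibnizAt lam D (x + x') y := by
  unfold LeibnizAt at *
  simp only [add_mul, map_add, h, h', smul_add]
  ring

theorem LeibnizAt.add_right {x y y' : S} (h : LeibnizAt lam D x y) (h' : LeibnizAt lam D x y') :
    LeibnizAt lam D x (y + y') :=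
  (h.symm.add_left h'.symm).symm

theorem LeibnizAt.smul_left {x y : S} (k : K) (h : LeibnizAt lam D x y) :
    LeibnizAt lam D (k • x) y := by
  unfold LeibnizAt at *
  simp only [smul_mul_assoc, map_smul, h, smul_add, smul_comm k lam]

theorem LeibnizAt.smul_right {x y : S} (k : K) (h : LeibnizAt lam D x y) :
    LeibnizAt lam D x (k • y) :=
  (h.symm.smul_left k).symm

theorem LeibnizAt.one_left (h : D 1 = 0) (y : S) : LeibnizAt lam D 1 y := by
  simp [LeibnizAt, h]

end LeibnizAt

/-! ### The extension to the free Rota-Baxter algebra -/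

namespace Sha

variable {K : Type*} [CommRing K] {lam : K} {A : Type*} [CommRing A] [Algebra K A]

open MixableShuffle

theorem toShuffle_tmul (u : A) (t : MixableShuffle lam A) :
    toShuffle (u ⊗ₜ[K] t) = cons u t := rfl

theorem P_tmul (u : A) (t : MixableShuffle lam A) :
    P (u ⊗ₜ[K] t) = (1 : A) ⊗ₜ[K] cons u t := rfl

theorem P_apply (u : Sha lam A) : P u = (1 : A) ⊗ₜ[K] toShuffle u := rfl

theorem incl_mul_tmul (u v : A) (t : MixableShuffle lam A) :
    incl u * (v ⊗ₜ[K] t : Sha lam A) = (u * v) ⊗ₜ[K] t := by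
  simp [incl, Algebra.TensorProduct.includeLeft_apply]

/-- On pure tensors this is the recursion of the mixable shuffle product with `1` put in front: its
three terms are the three terms of the identity. -/
theorem isRotaBaxter_P : IsRotaBaxter lam (P (lam := lam) (A := A) (K := K)) := by
  intro x y
  induction x using TensorProduct.induction_on with
  | zero => simp
  | add x x' h h' =>
    simp only [add_mul, map_add, smul_add, h, h']
    abel
  | tmul u t =>
    induction y using TensorProduct.induction_on with
    | zero => simp
    | add y y' h h' =>
      simp only [mul_add, map_add, smul_add, h, h']
      abel
    | tmul v s =>
      simp only [P_tmul, Algebra.TensorProduct.tmul_mul_tmul, one_mul, mul_one, cons_mul_cons,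
        TensorProduct.tmul_add, TensorProduct.tmul_smul]
      abel

/-- The recursion step used for `extendOne`. -/
def extendStep (a b c : K) (d : Module.End K A) :
    A →ₗ[K] Module.End K (Sha lam A × MixableShuffle lam A) :=
  LinearMap.mk₂ K
    -- The value at `cons v t` involves `t` itself besides the value at `t`, so the fold carries the
    -- tail along as second component.
    (fun v p => (a • (v ⊗ₜ[K] p.2) + b • P (v ⊗ₜ[K] p.2) +
      c • P (d v ⊗ₜ[K] p.2 + incl (v + lam • d v) * p.1), cons v p.2))
    (by
      intro v v' p
      refine Prod.ext ?_ (by simp)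
      simp only [Prod.fst_add, TensorProduct.add_tmul, map_add, add_mul, smul_add]
      abel)
    (by
      intro k v p
      refine Prod.ext ?_ (by simp)
      simp only [Prod.smul_fst, ← TensorProduct.smul_tmul', map_add, map_smul, add_mul, smul_add,
        smul_mul_assoc, smul_comm _ k])
    (by
      intro v p p'
      refine Prod.ext ?_ (by simp)
      simp only [Prod.fst_add, Prod.snd_add, TensorProduct.tmul_add, map_add, mul_add, smul_add]
      abel)
    (by
      intro k v p
      refine Prod.ext ?_ (by simp)
      simp only [Prod.smul_fst, Prod.smul_snd, TensorProduct.tmul_smul, map_add, map_smul,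
        smul_add, mul_smul_comm, smul_comm _ k])

/-- The restriction of `extend` to the tensors `1 ⊗ t`. -/
def extendOne (a b c : K) (d : Module.End K A) : MixableShuffle lam A →ₗ[K] Sha lam A :=
  (LinearMap.fst K _ _).comp (fold (extendStep a b c d) (0, 1))

/-- The extension of `d` attached to `xy - (a + y (b + c x))`. -/
def extend (a b c : K) (d : Module.End K A) : Module.End K (Sha lam A) :=
  TensorProduct.map d LinearMap.id + TensorProduct.lift
    ((LinearMap.mul K (Sha lam A)).compl₁₂
      ((incl (lam := lam)).toLinearMap.comp (LinearMap.id + lam • d)) (extendOne a b c d))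

variable (a b c : K) (d : Module.End K A)

theorem extend_tmul (u : A) (t : MixableShuffle lam A) :
    extend a b c d (u ⊗ₜ[K] t) = d u ⊗ₜ[K] t + incl (u + lam • d u) * extendOne a b c d t := rfl

theorem fold_extendStep_snd (t : MixableShuffle lam A) :
    (fold (extendStep a b c d) (0, 1) t).2 = t := by
  induction t using MixableShuffle.induction with
  | one => rw [fold_one]
  | smul k t ih => rw [map_smul, Prod.smul_snd, ih]
  | add s t hs ht => rw [map_add, Prod.snd_add, hs, ht]
  | hcons v t ih => rw [fold_cons]; exact congrArg (cons v) ih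

theorem extendOne_one : extendOne a b c d (1 : MixableShuffle lam A) = 0 := by
  rw [extendOne, LinearMap.comp_apply, fold_one]
  rfl

theorem extendOne_cons (v : A) (t : MixableShuffle lam A) :
    extendOne a b c d (cons v t) =
      a • (v ⊗ₜ[K] t) + b • P (v ⊗ₜ[K] t) + c • P (extend a b c d (v ⊗ₜ[K] t)) := by
  have h := fold_extendStep_snd a b c d t
  rw [extend_tmul, extendOne, LinearMap.comp_apply, fold_cons, LinearMap.comp_apply]
  generalize fold (extendStep a b c d) (0, 1) t = p at h ⊢
  subst h
  rfl

theorem extendOne_toShuffle (u : Sha lam A) :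
    extendOne a b c d (toShuffle u) = a • u + b • P u + c • P (extend a b c d u) := by
  induction u using TensorProduct.induction_on with
  | zero => simp
  | tmul v t => exact extendOne_cons a b c d v t
  | add u u' h h' =>
    simp only [map_add, smul_add, h, h']
    abel

variable {d} in
theorem extend_one_tmul (hd : d 1 = 0) (t : MixableShuffle lam A) :
    extend a b c d ((1 : A) ⊗ₜ[K] t) = extendOne a b c d t := by
  simp [extend_tmul, hd]

variable {d} in
-- Since `d 1 = 0`, the defining formula with head `1` is exactly the constraint for `extend` and
-- `P`.
theorem extend_P (hd : d 1 = 0) (u : Sha lam A) :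
    extend a b c d (P u) = a • u + b • P u + c • P (extend a b c d u) :=
  (extend_one_tmul a b c hd _).trans (extendOne_toShuffle a b c d u)

theorem isExtension_extend : IsExtension d (extend (lam := lam) a b c d) := by
  intro u
  change extend a b c d (u ⊗ₜ[K] 1) = _
  rw [extend_tmul, extendOne_one, mul_zero, add_zero]
  rfl

/-- As `φ` is constant and `ψ` has degree at most one, the formula for `q` only calls `q u` once,
never an iterate. -/
theorem aeval_add_P_mul_aeval (q : Module.End K (Sha lam A)) (u : Sha lam A) :
    (aeval q (C a) + P * aeval q (C b + C c * X) : Module.End K (Sha lam A)) u =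
      a • u + b • P u + c • P (q u) := by
  simp [Algebra.algebraMap_eq_smul_one, add_assoc]

/-! ### Stability of the filtration by tensor length -/

theorem upTo_mono {m n : ℕ} (h : m ≤ n) : upTo lam A m ≤ upTo lam A n :=
  Submodule.span_mono fun _ ⟨v, l, hl, hu⟩ => ⟨v, l, hl.trans h, hu⟩

theorem tmul_tensor_mem_upTo (v : A) {l : List A} {n : ℕ} (h : l.length + 1 ≤ n) :
    v ⊗ₜ[K] tensor l ∈ upTo lam A n :=
  Submodule.subset_span ⟨v, l, h, rfl⟩

theorem incl_mul_mem_upTo (v : A) {n : ℕ} {u : Sha lam A} (hu : u ∈ upTo lam A n) :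
    incl v * u ∈ upTo lam A n := by
  induction hu using Submodule.span_induction with
  | mem u h =>
    obtain ⟨w, l, hl, rfl⟩ := h
    rw [incl_mul_tmul]
    exact tmul_tensor_mem_upTo _ hl
  | zero => rw [mul_zero]; exact zero_mem _
  | add u u' _ _ h h' => rw [mul_add]; exact add_mem h h'
  | smul k u _ h => rw [mul_smul_comm]; exact Submodule.smul_mem _ _ h

theorem P_mem_upTo {n : ℕ} {u : Sha lam A} (hu : u ∈ upTo lam A n) :
    P u ∈ upTo lam A (n + 1) := by
  induction hu using Submodule.span_induction with
  | mem u h =>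
    obtain ⟨w, l, hl, rfl⟩ := h
    exact tmul_tensor_mem_upTo (l := w :: l) _ (by simpa using hl)
  | zero => rw [map_zero]; exact zero_mem _
  | add u u' _ _ h h' => rw [map_add]; exact add_mem h h'
  | smul k u _ h => rw [map_smul]; exact Submodule.smul_mem _ _ h

/-- `P` adds one factor, but is applied only to tensors that have already lost their head. -/
theorem extend_tmul_tensor_mem_upTo (l : List A) (v : A) :
    extend a b c d (v ⊗ₜ[K] tensor l) ∈ upTo lam A (l.length + 1) := by
  induction l generalizing v with
  | nil =>
    change extend a b c d (v ⊗ₜ[K] 1) ∈ _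
    rw [extend_tmul, extendOne_one, mul_zero, add_zero]
    exact tmul_tensor_mem_upTo (l := []) _ le_rfl
  | cons w l ih =>
    rw [extend_tmul]
    refine add_mem (tmul_tensor_mem_upTo _ le_rfl) (incl_mul_mem_upTo _ ?_)
    change extendOne a b c d (cons w (tensor l)) ∈ _
    rw [extendOne_cons]
    have hw : w ⊗ₜ[K] tensor l ∈ upTo lam A (l.length + 1) := tmul_tensor_mem_upTo _ le_rfl
    exact add_mem (add_mem (Submodule.smul_mem _ _ (upTo_mono (Nat.le_succ _) hw))
      (Submodule.smul_mem _ _ (P_mem_upTo hw))) (Submodule.smul_mem _ _ (P_mem_upTo (ih w)))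

theorem extend_mem_upTo {n : ℕ} {u : Sha lam A} (hu : u ∈ upTo lam A n) :
    extend a b c d u ∈ upTo lam A n := by
  induction hu using Submodule.span_induction with
  | mem u h =>
    obtain ⟨w, l, hl, rfl⟩ := h
    exact upTo_mono hl (extend_tmul_tensor_mem_upTo a b c d l w)
  | zero => rw [map_zero]; exact zero_mem _
  | add u u' _ _ h h' => rw [map_add]; exact add_mem h h'
  | smul k u _ h => rw [map_smul]; exact Submodule.smul_mem _ _ h

theorem isOmegaExtension_extend :
    IsOmegaExtension (affineConstraint a b c) d (extend (lam := lam) a b c d) := by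
  refine ⟨isExtension_extend a b c d, ⟨_, _, rfl, fun u₀ u' => ?_⟩,
    fun n _ u hu => extend_mem_upTo a b c d hu⟩
  rw [aeval_add_P_mul_aeval, extend_tmul, extendOne_toShuffle]

/-! ### Uniqueness and Leibniz rule of the extension -/

variable {a b c d}

theorem eq_of_isOmegaExtension {q₁ q₂ : Module.End K (Sha lam A)}
    (h₁ : IsOmegaExtension (affineConstraint a b c) d q₁)
    (h₂ : IsOmegaExtension (affineConstraint a b c) d q₂) : q₁ = q₂ := by
  have key {q : Module.End K (Sha lam A)} (h : IsOmegaExtension (affineConstraint a b c) d q)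
      (u₀ : A) (u' : Sha lam A) : q (u₀ ⊗ₜ[K] toShuffle u') = d u₀ ⊗ₜ[K] toShuffle u' +
        incl (u₀ + lam • d u₀) * (a • u' + b • P u' + c • P (q u')) := by
    obtain ⟨-, ⟨φ, ψ, hφψ, h⟩, -⟩ := h
    -- The polynomials in the definition are existentially quantified; injectivity identifies them
    -- with the affine ones.
    obtain ⟨rfl, rfl⟩ := omegaPoly_injective hφψ
    rw [h, aeval_add_P_mul_aeval]
  refine TensorProduct.ext' fun u t => ?_
  induction t using MixableShuffle.induction generalizing u with
  | one => exact (h₁.1 u).trans (h₂.1 u).symm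
  | smul k t ih => rw [TensorProduct.tmul_smul, map_smul, map_smul, ih]
  | add s t hs ht => rw [TensorProduct.tmul_add, map_add, map_add, hs, ht]
  | hcons v t ih => rw [← toShuffle_tmul, key h₁, key h₂, ih]

/-- The formula for `extend` on `u ⊗ t` is the Leibniz rule for the product of `u` and `1 ⊗ t`, so
heads can be factored out and only the case of heads `1` matters. -/
theorem leibnizAt_extend_tmul (hd : IsDifferential lam d) {t s : MixableShuffle lam A}
    (h : LeibnizAt lam (extend a b c d) ((1 : A) ⊗ₜ[K] t) ((1 : A) ⊗ₜ[K] s)) (u v : A) :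
    LeibnizAt lam (extend a b c d) (u ⊗ₜ[K] t) (v ⊗ₜ[K] s) := by
  -- With heads written as factors, the claim becomes a polynomial identity in the commutative ring
  -- `Sha lam A`.
  have e (w : A) (r : MixableShuffle lam A) : w ⊗ₜ[K] r = incl w * ((1 : A) ⊗ₜ[K] r) := by
    rw [incl_mul_tmul, mul_one]
  unfold LeibnizAt at *
  rw [Algebra.TensorProduct.tmul_mul_tmul] at *
  rw [one_mul] at h
  simp only [extend_one_tmul a b c hd.2] at h
  simp only [extend_tmul, h, hd.1]
  rw [e (d u * v + u * d v + lam • (d u * d v)), e (d u), e (d v), e u, e v,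
    show (1 : A) ⊗ₜ[K] (t * s) = ((1 : A) ⊗ₜ[K] t) * ((1 : A) ⊗ₜ[K] s) by simp]
  simp only [map_add, map_mul, AlgHom.commutes, Algebra.smul_def]
  ring

/-- Double induction on the tails: when both are nonempty, both factors lie in the image of `P`, and
the Leibniz rule propagates along `P`. -/
theorem leibnizAt_extend_one_tmul (habc : IsCompatible lam a b c) (hd : IsDifferential lam d)
    (t s : MixableShuffle lam A) :
    LeibnizAt lam (extend a b c d) ((1 : A) ⊗ₜ[K] t) ((1 : A) ⊗ₜ[K] s) := by
  have hone : extend a b c d (1 : Sha lam A) = 0 := by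
    rw [Algebra.TensorProduct.one_def, extend_one_tmul a b c hd.2, extendOne_one]
  induction t using MixableShuffle.induction generalizing s with
  | one => exact .one_left hone _
  | smul k t ih => rw [TensorProduct.tmul_smul]; exact (ih s).smul_left k
  | add t t' h h' => rw [TensorProduct.tmul_add]; exact (h s).add_left (h' s)
  | hcons u t iht =>
    induction s using MixableShuffle.induction with
    | one => exact (LeibnizAt.one_left hone _).symm
    | smul k s ih => rw [TensorProduct.tmul_smul]; exact ih.smul_right k
    | add s s' h h' => rw [TensorProduct.tmul_add]; exact h.add_right h'
    | hcons v s ihs =>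
      rw [← P_tmul, ← P_tmul]
      exact LeibnizAt.of_isRotaBaxter habc (extend_P a b c hd.2) isRotaBaxter_P
        -- The pairs needed have tails `(cons u t, s)`, `(t, cons v s)` and `(t, s)`, each with a
        -- head stripped from at least one side.
        (leibnizAt_extend_tmul hd ihs 1 v) (leibnizAt_extend_tmul hd (iht (cons v s)) u 1)
        (leibnizAt_extend_tmul hd (iht s) u v)

theorem isDifferential_extend (habc : IsCompatible lam a b c) (hd : IsDifferential lam d) :
    IsDifferential lam (extend (lam := lam) a b c d) := by
  refine ⟨fun x y => ?_, ?_⟩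
  · change LeibnizAt lam (extend a b c d) x y
    induction x using TensorProduct.induction_on with
    | zero => simp [LeibnizAt]
    | add x x' h h' => exact h.add_left h'
    | tmul u t =>
      induction y using TensorProduct.induction_on with
      | zero => simp [LeibnizAt]
      | add y y' h h' => exact h.add_right h'
      | tmul v s => exact leibnizAt_extend_tmul hd (leibnizAt_extend_one_tmul habc hd t s) u v
  · rw [Algebra.TensorProduct.one_def, extend_one_tmul a b c hd.2, extendOne_one]

end Sha

/-! ### The corollary -/

theorem mainTheorem3 {K : Type*} [CommRing K] {R : Type*} [CommRing R] [Algebra K R]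
    (lam : K) (ω : NCPoly K) (hω : (lam = 0 ∧ ω ∈ Omega0 K) ∨ ω ∈ OmegaK K)
    (P d : Module.End K R) (hP : IsRotaBaxter lam P) (hd : IsDifferential lam d) :
    (∃ P' : Module.End K (HurwitzSeries lam R), IsOmegaCover ω P P' ∧
      (∀ Q' : Module.End K (HurwitzSeries lam R), IsOmegaCover ω P Q' → Q' = P') ∧
      IsTypeDRB lam ω HurwitzSeries.deriv P') ∧
    (∃ d' : Module.End K (Sha lam R), IsOmegaExtension ω d d' ∧
      (∀ q' : Module.End K (Sha lam R), IsOmegaExtension ω d q' → q' = d') ∧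
      IsTypeDRB lam ω d' Sha.P) := by
  obtain ⟨a, b, c, rfl, habc⟩ := exists_affineConstraint hω
  have hcover := HurwitzSeries.isOmegaCover_cover (lam := lam) a b c P
  have hext := Sha.isOmegaExtension_extend (lam := lam) a b c d
  exact ⟨⟨_, hcover, fun _ h => HurwitzSeries.eq_of_isOmegaCover h hcover,
      HurwitzSeries.isDifferential_deriv, HurwitzSeries.isRotaBaxter_cover habc hP, hcover.2⟩,
    ⟨_, hext, fun _ h => Sha.eq_of_isOmegaExtension h hext,
      Sha.isDifferential_extend habc hd, Sha.isRotaBaxter_P,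
      (evalOp_affineConstraint_eq_zero_iff ..).2 (Sha.extend_P a b c hd.2)⟩⟩
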